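/- Let $V$ be a finite-dimensional real vector space. A model on $V$ is a triple $\mathfrak M=(V,\varphi,R)$, where $\varphi$ is a nondegenerate symmetric bilinear form on $V$ and $R\in\otimes^4V^*$ is an algebraic curvature tensor: $R(x,y,z,w)=-R(y,x,z,w)=R(z,w,x,y)$ and $R(x,y,z,w)+R(x,z,w,y)+R(x,w,y,z)=0$. It is Riemannian if $\varphi$ is positive definite, and skew-Tsankov if $\mathcal R(x,y)\mathcal R(z,w)=\mathcal R(z,w)\mathcal R(x,y)$ for all $x,y,z,w\in V$, where $R(x,y,z,w)=\varphi(\mathcal R(x,y)z,w)$. A decomposition of $\mathfrak M$ of length $s$ is a direct sum $V=V_1\oplus\dots\oplus V_s\oplus U$ with $\dim V_i=2$ and $R|_U=0$, such that $\varphi(x,y)=0$ and $R(x,y,z,w)=0$ for all $z,w\in V$ whenever $x$ and $y$ lie in two different summands. Let $\mathfrak M_i=(V_i,\varphi|_{V_i},R|_{V_i})$; when $\varphi$ is positive definite, its sectional curvature is $\kappa_i=R(x,y,y,x)/(\varphi(x,x)\varphi(y,y)-\varphi(x,y)^2)$ for any basis $x,y$ of $V_i$. For $A\in GL(V)$ let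 $A^*\mathfrak M=(V,A^*\varphi,A^*R)$, where $A^*$ is precomposition with $A$ in every slot. For a subset of the tensors $\{\varphi,R\}$, forming a model space $\mathfrak M'$, the structure group $G_{\mathfrak M'}$ is the group of all $A\in GL(V)$ with $A^*\beta=\beta$ for each tensor $\beta$ of $\mathfrak M'$. A function $\alpha$ of models on $V$, with values in a set $K$, is an invariant of $\mathfrak M$ (relative to $\mathfrak M'$) if $\alpha(A^*\mathfrak M)=\alpha(\mathfrak M)$ for all $A\in G_{\mathfrak M'}$. **Theorem.** Let $\mathfrak M=(V,\varphi,R)$ be a Riemannian skew-Tsankov model. 1. $\mathfrak M$ has a decomposition $\mathfrak M=\bigoplus_{i=1}^s\mathfrak M_i\oplus\mathfrak K$, $\mathfrak K=(U,\varphi|_U,0)$, with $U=\ker R=\{v\in V: R(v,x,y,z)=0\text{ for all }x,y,z\in V\}$, and the length $s$ of a decomposition with $U=\ker R$ is determined by $\mathfrak M$. 2. Suppose that $\mathfrak M$ has a decomposition of length $s$, and let $F:\mathbb R^s\to K$ be any symmetric function, with values in an arbitrary set $K$. Then $F(\kappa_1,\dots,\kappa_s)$ is a well-defined function of Riemannian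 skew-Tsankov models: there is a function $\alpha$ of models on $V$ such that $\alpha(\mathfrak N)=F(\kappa_1,\dots,\kappa_s)$ for every Riemannian skew-Tsankov model $\mathfrak N$ on $V$ and every decomposition of $\mathfrak N$ of length $s$, where the $\kappa_i$ are the sectional curvatures of its two-dimensional summands. Every such function $\alpha$ is an invariant of $\mathfrak M$, relative to each of the four model spaces $\mathfrak M'$ formed by $V$ and a subset of the tensors $\{\varphi,R\}$. -/

import Mathlib

/-- Four-linear real-valued forms (contravariant tensors of degree four) on `V`, in curried form. -/
abbrev FourForm (V : Type*) [AddCommGroup V] [Module ℝ V] : Type _ :=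
  V →ₗ[ℝ] V →ₗ[ℝ] V →ₗ[ℝ] V →ₗ[ℝ] ℝ

/-- Algebraic curvature tensors. -/
structure IsAlgebraicCurvatureTensor {V : Type*} [AddCommGroup V] [Module ℝ V]
    (R : FourForm V) : Prop where
  antisymm : ∀ x y z w, R x y z w = -R y x z w
  pair_symm : ∀ x y z w, R x y z w = R z w x y
  bianchi : ∀ x y z w, R x y z w + R x z w y + R x w y z = 0

/-- A model space `(V, φ, R)`: a nondegenerate symmetric bilinear form `φ` and an algebraic
curvature tensor `R` on `V`. -/
structure CurvatureModel (V : Type*) [AddCommGroup V] [Module ℝ V] where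
  /-- the inner product -/
  metric : LinearMap.BilinForm ℝ V
  metric_symm : ∀ x y, metric x y = metric y x
  metric_nondegenerate : metric.Nondegenerate
  /-- the curvature tensor -/
  curv : FourForm V
  curv_algebraic : IsAlgebraicCurvatureTensor curv

/-- The tensors of a model space `(V, φ, R)`. -/
inductive TensorLabel
  | metric
  | curv

/-- The action of `A ∈ GL(V)` on bilinear forms by precomposition. -/
noncomputable def pullbackBilin {V : Type*} [AddCommGroup V] [Module ℝ V]
    (A : V ≃ₗ[ℝ] V) (b : LinearMap.BilinForm ℝ V) : LinearMap.BilinForm ℝ V :=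
  b.compl₁₂ (A : V →ₗ[ℝ] V) (A : V →ₗ[ℝ] V)

/-- The action of `A ∈ GL(V)` on four-linear forms by precomposition. -/
noncomputable def pullbackFour {V : Type*} [AddCommGroup V] [Module ℝ V]
    (A : V ≃ₗ[ℝ] V) (R : FourForm V) : FourForm V :=
  A.symm.arrowCongr (A.symm.arrowCongr (A.symm.arrowCongr
    (A.symm.arrowCongr (LinearEquiv.refl ℝ ℝ)))) R

theorem pullbackBilin_apply {V : Type*} [AddCommGroup V] [Module ℝ V]
    (A : V ≃ₗ[ℝ] V) (b : LinearMap.BilinForm ℝ V) (x y : V) :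
    pullbackBilin A b x y = b (A x) (A y) := rfl

theorem pullbackFour_apply {V : Type*} [AddCommGroup V] [Module ℝ V]
    (A : V ≃ₗ[ℝ] V) (R : FourForm V) (x y z w : V) :
    pullbackFour A R x y z w = R (A x) (A y) (A z) (A w) := rfl

namespace CurvatureModel

variable {V : Type*} [AddCommGroup V] [Module ℝ V]

/-- A model is Riemannian if its inner product is positive definite. -/
def IsRiemannian (M : CurvatureModel V) : Prop :=
  ∀ x : V, x ≠ 0 → 0 < M.metric x x

/-- The skew-symmetric curvature operator `𝓡(x, y)`; see `metric_curvOp` for its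
characterization. -/
noncomputable def curvOp [FiniteDimensional ℝ V] (M : CurvatureModel V) (x y : V) :
    V →ₗ[ℝ] V :=
  ((M.metric.toDual M.metric_nondegenerate).symm : Module.Dual ℝ V →ₗ[ℝ] V) ∘ₗ M.curv x y

theorem metric_curvOp [FiniteDimensional ℝ V] (M : CurvatureModel V) (x y z w : V) :
    M.metric (M.curvOp x y z) w = M.curv x y z w :=
  LinearMap.BilinForm.apply_toDual_symm_apply (hB := M.metric_nondegenerate) _ _

/-- A model is skew-Tsankov if its skew-symmetric curvature operators commute. -/
def IsSkewTsankov [FiniteDimensional ℝ V] (M : CurvatureModel V) : Prop :=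
  ∀ x y z w : V, M.curvOp x y ∘ₗ M.curvOp z w = M.curvOp z w ∘ₗ M.curvOp x y

/-- The kernel of the curvature tensor. -/
def kerCurv (M : CurvatureModel V) : Submodule ℝ V := LinearMap.ker M.curv

theorem mem_kerCurv (M : CurvatureModel V) (v : V) :
    v ∈ M.kerCurv ↔ ∀ x y z, M.curv v x y z = 0 := by
  constructor
  · intro h x y z
    have h' : M.curv v = 0 := h
    simp [h']
  · intro h
    refine LinearMap.mem_ker.2 ?_
    ext x y z
    exact h x y z

/-- The model `A^* M = (V, A^* φ, A^* R)` for `A ∈ GL(V)`. -/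
noncomputable def pullback (M : CurvatureModel V) (A : V ≃ₗ[ℝ] V) : CurvatureModel V where
  metric := pullbackBilin A M.metric
  metric_symm x y := M.metric_symm (A x) (A y)
  metric_nondegenerate := by
    obtain ⟨h₁, h₂⟩ := M.metric_nondegenerate
    constructor
    · intro x hx
      refine A.map_eq_zero_iff.1 (h₁ (A x) fun y => ?_)
      simpa [pullbackBilin_apply] using hx (A.symm y)
    · intro x hx
      refine A.map_eq_zero_iff.1 (h₂ (A x) fun y => ?_)
      simpa [pullbackBilin_apply] using hx (A.symm y)
  curv := pullbackFour A M.curv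
  curv_algebraic :=
    { antisymm := fun x y z w => M.curv_algebraic.antisymm (A x) (A y) (A z) (A w)
      pair_symm := fun x y z w => M.curv_algebraic.pair_symm (A x) (A y) (A z) (A w)
      bianchi := fun x y z w => M.curv_algebraic.bianchi (A x) (A y) (A z) (A w) }

/-- `A` preserves the tensor with the given label. -/
def Preserves (M : CurvatureModel V) (A : V ≃ₗ[ℝ] V) : TensorLabel → Prop
  | .metric => pullbackBilin A M.metric = M.metric
  | .curv => pullbackFour A M.curv = M.curv

/-- The structure group of the model space `M'` that consists of `V` and the tensors of `M` with
labels in `T`: all elements of `GL(V)` that preserve these tensors. -/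
def structureGroup (M : CurvatureModel V) (T : Set TensorLabel) : Set (V ≃ₗ[ℝ] V) :=
  {A | ∀ t ∈ T, M.Preserves A t}

/-- A `K`-valued function `α` of models on `V` is an invariant of `M`, relative to the model space
`M'` formed by the tensors of `M` with labels in `T`, if its value at `M` does not change under the
action of the structure group of `M'` on the tensors of `M`. -/
def IsInvariant {K : Type*} (M : CurvatureModel V) (T : Set TensorLabel)
    (α : CurvatureModel V → K) : Prop :=
  ∀ A ∈ M.structureGroup T, α (M.pullback A) = α M

/-- A decomposition `M = M₁ ⊕ ⋯ ⊕ Mₛ ⊕ 𝔎` of a model space into `s` two-dimensional summands,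
supported on `plane i`, and a summand with zero curvature, supported on `flat`. -/
structure Decomposition (M : CurvatureModel V) (s : ℕ) where
  /-- the underlying spaces of the two-dimensional summands -/
  plane : Fin s → Submodule ℝ V
  /-- the underlying space of the flat summand -/
  flat : Submodule ℝ V
  finrank_plane : ∀ i, Module.finrank ℝ (plane i) = 2
  isInternal : DirectSum.IsInternal (fun o : Option (Fin s) => o.elim flat plane)
  metric_perp : ∀ o o' : Option (Fin s), o ≠ o' →
    ∀ x ∈ o.elim flat plane, ∀ y ∈ o'.elim flat plane, M.metric x y = 0
  curv_perp : ∀ o o' : Option (Fin s), o ≠ o' →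
    ∀ x ∈ o.elim flat plane, ∀ y ∈ o'.elim flat plane, ∀ z w, M.curv x y z w = 0
  curv_flat : ∀ x ∈ flat, ∀ y ∈ flat, ∀ z ∈ flat, ∀ w ∈ flat, M.curv x y z w = 0

/-- The sectional curvature of the plane spanned by `x` and `y`. -/
noncomputable def sectionalCurvature (M : CurvatureModel V) (x y : V) : ℝ :=
  M.curv x y y x / (M.metric x x * M.metric y y - M.metric x y ^ 2)

namespace Decomposition

variable [FiniteDimensional ℝ V] {M : CurvatureModel V} {s : ℕ}

/-- The sectional curvature `κ i` of the `i`-th two-dimensional summand, computed in some basis of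
its plane; by `curvature_eq` any basis gives the same value. -/
noncomputable def curvature (D : M.Decomposition s) (i : Fin s) : ℝ :=
  M.sectionalCurvature (Module.finBasisOfFinrankEq ℝ (D.plane i) (D.finrank_plane i) 0 : D.plane i)
    (Module.finBasisOfFinrankEq ℝ (D.plane i) (D.finrank_plane i) 1 : D.plane i)

end Decomposition

theorem sectionalCurvature_change (M : CurvatureModel V) (e f : V) (a b c d : ℝ)
    (h : a * d - b * c ≠ 0) :
    M.sectionalCurvature (a • e + b • f) (c • e + d • f) = M.sectionalCurvature e f := by
  have hs := M.metric_symm f e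
  have hR := M.curv_algebraic
  have h1 : ∀ x z w, M.curv x x z w = 0 := fun x z w => by
    have := hR.antisymm x x z w
    linarith
  have h2 : ∀ x y z, M.curv x y z z = 0 := fun x y z => by
    rw [hR.pair_symm, h1]
  have h3 : M.curv f e f e = -M.curv e f f e := by rw [hR.antisymm]
  have h5 : M.curv f e e f = M.curv e f f e := hR.pair_symm f e e f
  have h4 : M.curv e f e f = -M.curv e f f e := by rw [hR.antisymm, h5]
  unfold sectionalCurvature
  have hn : M.curv (a • e + b • f) (c • e + d • f) (c • e + d • f) (a • e + b • f)
      = (a * d - b * c) ^ 2 * M.curv e f f e := by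
    simp only [map_add, map_smul, LinearMap.add_apply, LinearMap.smul_apply, smul_eq_mul,
      h1, h2, h3, h4, h5]
    ring
  have hd : M.metric (a • e + b • f) (a • e + b • f) * M.metric (c • e + d • f) (c • e + d • f)
      - M.metric (a • e + b • f) (c • e + d • f) ^ 2
      = (a * d - b * c) ^ 2 * (M.metric e e * M.metric f f - M.metric e f ^ 2) := by
    simp only [map_add, map_smul, LinearMap.add_apply, LinearMap.smul_apply, smul_eq_mul, hs]
    ring
  rw [hn, hd, mul_div_mul_left _ _ (pow_ne_zero 2 h)]

namespace Decomposition

variable [FiniteDimensional ℝ V] {M : CurvatureModel V} {s : ℕ}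

theorem curvature_eq (D : M.Decomposition s) (i : Fin s)
    (b : Module.Basis (Fin 2) ℝ (D.plane i)) :
    D.curvature i = M.sectionalCurvature (b 0 : D.plane i) (b 1 : D.plane i) := by
  set e := Module.finBasisOfFinrankEq ℝ (D.plane i) (D.finrank_plane i) with he
  have hx : ∀ j, ((b j : D.plane i) : V)
      = e.repr (b j) 0 • ((e 0 : D.plane i) : V) + e.repr (b j) 1 • ((e 1 : D.plane i) : V) := by
    intro j
    have := e.sum_repr (b j)
    rw [Fin.sum_univ_two] at this
    conv_lhs => rw [← this]
    simp
  have hdet : e.repr (b 0) 0 * e.repr (b 1) 1 - e.repr (b 0) 1 * e.repr (b 1) 0 ≠ 0 := by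
    have h := (e.isUnit_det b).ne_zero
    rw [Module.Basis.det_apply, Matrix.det_fin_two] at h
    simp only [Module.Basis.toMatrix_apply] at h
    intro h0
    apply h
    linarith
  rw [hx 0, hx 1, sectionalCurvature_change _ _ _ _ _ _ _ hdet]
  rfl

end Decomposition

/-- The function `α` of models is `F(κ₁, …, κₛ)`: on each Riemannian skew-Tsankov model on `V`, its
value is obtained by applying `F` to the sectional curvatures of the two-dimensional summands of
any decomposition with `s` such summands. -/
def IsCurvatureFunction [FiniteDimensional ℝ V] {K : Type*} {s : ℕ} (F : (Fin s → ℝ) → K)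
    (α : CurvatureModel V → K) : Prop :=
  ∀ N : CurvatureModel V, N.IsRiemannian → N.IsSkewTsankov →
    ∀ E : N.Decomposition s, α N = F E.curvature

end CurvatureModel

/-- Symmetric functions of `s` real variables with values in an arbitrary set. -/
def IsSymmetricFunction {K : Type*} {s : ℕ} (F : (Fin s → ℝ) → K) : Prop :=
  ∀ (σ : Equiv.Perm (Fin s)) (k : Fin s → ℝ), F (k ∘ σ) = F k

/-! Existence is simultaneous normal form. For positive definite `φ` the operators `𝓡(z, w)` are
skew-adjoint, and they commute by hypothesis. Their pairwise products are then symmetric and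
commute, hence have joint eigenvectors. A joint eigenvector `v` with `A v ≠ 0` for some operator `A`
spans with `A v` a plane invariant under the whole family
(`exists_invariant_plane_of_commute_skew`). Splitting off such planes orthogonally leaves the common
kernel, which is `ker R` because `R(x, y, z, w) = φ(𝓡(z, w) x, y)`.

Uniqueness comes from the Ricci operator: it acts as `κ i` on the `i`-th plane and as `0` on the
flat part, so its characteristic polynomial is `X ^ dim U * ∏ (X - κ i) ^ 2` (`charpoly_ricciOp`).
Once `s` is fixed, `dim U = dim V - 2 s` is fixed too, and the roots give the `κ i` up to order. For
`U = ker R` the same dimension count determines `s`.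

Invariance holds under all of `GL(V)`, hence under every structure group: `A` transports
decompositions together with their sectional curvatures. -/

/-! ### Commuting families of skew-adjoint maps -/

section CommutingSkew

open Module End
open scoped InnerProductSpace

variable {E ι : Type*} [NormedAddCommGroup E] [InnerProductSpace ℝ E] [FiniteDimensional ℝ E]

/-- A joint eigenvector of the products of two members of a commuting family of skew-adjoint
maps, on which some member does not vanish. -/
theorem exists_joint_eigenvector_of_commute_skew {A : ι → E →ₗ[ℝ] E}
    (hskew : ∀ i x y, ⟪A i x, y⟫_ℝ = -⟪x, A i y⟫_ℝ)
    (hcomm : ∀ i j x, A i (A j x) = A j (A i x))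
    {W : Submodule ℝ E} (hW : ∀ i, ∀ x ∈ W, A i x ∈ W)
    (hne : ∃ x ∈ W, ∃ i, A i x ≠ 0) :
    ∃ v ∈ W, (∃ i, A i v ≠ 0) ∧ ∀ i j, ∃ c : ℝ, A i (A j v) = c • v := by
  by_contra! hcon
  have hinv : ∀ p : ι × ι, ∀ x ∈ W, (A p.1 ∘ₗ A p.2) x ∈ W :=
    fun p x hx => hW _ _ (hW _ _ hx)
  let T : ι × ι → W →ₗ[ℝ] W := fun p => (A p.1 ∘ₗ A p.2).restrict (hinv p)
  -- The adjoint of `A i A j` is `A j A i`, which is the same map by commutativity.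
  have hsymm : ∀ p, (T p).IsSymmetric := by
    intro p x y
    change ⟪A p.1 (A p.2 x), (y : E)⟫_ℝ = ⟪(x : E), A p.1 (A p.2 y)⟫_ℝ
    rw [hskew, hskew, neg_neg, hcomm]
  have hT : Pairwise (Function.onFun Commute T) := by
    intro p q _
    refine LinearMap.ext fun x => Subtype.ext ?_
    change A p.1 (A p.2 (A q.1 (A q.2 x))) = A q.1 (A q.2 (A p.1 (A p.2 x)))
    rw [hcomm p.2 q.1, hcomm p.1 q.1, hcomm p.2 q.2, hcomm p.1 q.2]
  have htop := LinearMap.IsSymmetric.iSup_iInf_eq_top_of_commute hsymm hT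
  obtain ⟨x, hx, i, hi⟩ := hne
  -- If no suitable vector existed, each joint eigenspace would be killed by `A i`; as these spaces
  -- span `W`, so would `W`.
  have hle : (⨆ χ : ι × ι → ℝ, ⨅ p, eigenspace (T p) (χ p)) ≤
      LinearMap.ker (A i ∘ₗ W.subtype) := by
    refine iSup_le fun χ v hv => ?_
    by_contra hvi
    obtain ⟨j, k, hjk⟩ := hcon v v.2 ⟨i, hvi⟩
    refine hjk (χ (j, k)) ?_
    have h := mem_eigenspace_iff.1 (Submodule.mem_iInf _ |>.1 hv (j, k))
    exact congrArg Subtype.val h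
  exact hi (hle (htop ▸ Submodule.mem_top : (⟨x, hx⟩ : W) ∈ _))

/-- A nonzero invariant plane of a commuting family of skew-adjoint maps, orthogonal to their
common kernel. -/
theorem exists_invariant_plane_of_commute_skew {A : ι → E →ₗ[ℝ] E}
    (hskew : ∀ i x y, ⟪A i x, y⟫_ℝ = -⟪x, A i y⟫_ℝ)
    (hcomm : ∀ i j x, A i (A j x) = A j (A i x))
    {W : Submodule ℝ E} (hW : ∀ i, ∀ x ∈ W, A i x ∈ W)
    (hne : ∃ x ∈ W, ∃ i, A i x ≠ 0) :
    ∃ P ≤ W, finrank ℝ P = 2 ∧ (∀ i, ∀ x ∈ P, A i x ∈ P) ∧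
      ∀ x, (∀ i, A i x = 0) → ∀ y ∈ P, ⟪x, y⟫_ℝ = 0 := by
  obtain ⟨v, hvW, ⟨i, hi⟩, hv⟩ := exists_joint_eigenvector_of_commute_skew hskew hcomm hW hne
  have hself : ∀ j x, ⟪x, A j x⟫_ℝ = 0 := fun j x => by
    have := hskew j x x
    rw [real_inner_comm] at this
    linarith
  obtain ⟨c, hc⟩ := hv i i
  have hc0 : c ≠ 0 := by
    rintro rfl
    have h := hskew i v (A i v)
    rw [hc, zero_smul, inner_zero_right, neg_zero] at h
    exact hi (inner_self_eq_zero.1 h)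
  -- This makes the plane invariant under the whole family. The difference `w` below lies in `ker (A
  -- i)`, and is orthogonal to both `A j v` and `A i v`, hence to itself.
  have hmul : ∀ j, ∃ t : ℝ, A j v = t • A i v := by
    intro j
    obtain ⟨d, hd⟩ := hv i j
    refine ⟨d / c, sub_eq_zero.1 ?_⟩
    have hker : A i (A j v - (d / c) • A i v) = 0 := by
      rw [map_sub, map_smul, hd, hc, smul_smul, div_mul_cancel₀ _ hc0, sub_self]
    set w := A j v - (d / c) • A i v with hw
    have h1 : ⟪w, A j v⟫_ℝ = 0 := by
      have h2 : ⟪A j w, v⟫_ℝ = 0 := by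
        -- Writing `v` as a multiple of `A i (A i v)` lets one factor `A i` pass across the inner
        -- product and through `A j` to `w`, which it kills.
        have hv' : v = c⁻¹ • A i (A i v) := by
          rw [hc, smul_smul, inv_mul_cancel₀ hc0, one_smul]
        rw [hv', inner_smul_right, ← neg_eq_iff_eq_neg.2 (hskew i (A j w) (A i v)), hcomm, hker]
        simp
      rw [hskew] at h2
      linarith
    have h3 : ⟪w, A i v⟫_ℝ = 0 := by
      have := hskew i w v
      rw [hker, inner_zero_left] at this
      linarith
    refine inner_self_eq_zero (𝕜 := ℝ).1 ?_
    conv_lhs => rw [hw]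
    rw [← hw, inner_sub_left, inner_smul_left, real_inner_comm, h1, real_inner_comm, h3]
    simp
  refine ⟨Submodule.span ℝ {v, A i v}, ?_, ?_, ?_, ?_⟩
  · rw [Submodule.span_le]
    rintro x (rfl | rfl)
    exacts [hvW, hW _ _ hvW]
  · have hli : LinearIndependent ℝ ![v, A i v] := by
      rw [LinearIndependent.pair_iff]
      intro s t hst
      have h1 := congrArg (fun u => ⟪A i v, u⟫_ℝ) hst
      simp only [inner_add_right, inner_smul_right, inner_zero_right] at h1
      rw [real_inner_comm, hself, mul_zero, zero_add] at h1
      have ht : t = 0 := (mul_eq_zero.1 h1).resolve_right (fun h => hi (inner_self_eq_zero.1 h))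
      subst ht
      rw [zero_smul, add_zero] at hst
      exact ⟨(smul_eq_zero.1 hst).resolve_right (fun h => hi (by rw [h, map_zero])), rfl⟩
    have := finrank_span_eq_card hli
    rwa [Matrix.range_cons_cons_empty, Fintype.card_fin] at this
  · intro j x hx
    obtain ⟨a, b, rfl⟩ := Submodule.mem_span_pair.1 hx
    obtain ⟨t, ht⟩ := hmul j
    rw [map_add, map_smul, map_smul, hcomm j i, ht, map_smul, hc]
    refine Submodule.mem_span_pair.2 ⟨b * t * c, a * t, ?_⟩
    module
  -- Both `v` and `A i v` lie in the range of `A i`, which is orthogonal to its kernel by skewness.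
  · intro x hx y hy
    obtain ⟨a, b, rfl⟩ := Submodule.mem_span_pair.1 hy
    have h1 : ⟪x, A i v⟫_ℝ = 0 := by
      have := hskew i x v
      rw [hx, inner_zero_left] at this
      linarith
    have h2 : ⟪x, v⟫_ℝ = 0 := by
      have := hskew i x (A i v)
      rw [hx, inner_zero_left, hc, inner_smul_right] at this
      exact (mul_eq_zero.1 (neg_eq_zero.1 this.symm)).resolve_left hc0
    rw [inner_add_right, inner_smul_right, inner_smul_right, h1, h2]
    simp

/-- A commuting family of skew-adjoint maps splits the space into pairwise orthogonal invariant
planes and the common kernel. -/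
theorem exists_orthogonal_invariant_planes {A : ι → E →ₗ[ℝ] E}
    (hskew : ∀ i x y, ⟪A i x, y⟫_ℝ = -⟪x, A i y⟫_ℝ)
    (hcomm : ∀ i j x, A i (A j x) = A j (A i x))
    (W : Submodule ℝ E) (hW : ∀ i, ∀ x ∈ W, A i x ∈ W) :
    ∃ (s : ℕ) (P : Fin s → Submodule ℝ E), (∀ k, P k ≤ W) ∧ (∀ k, finrank ℝ (P k) = 2) ∧
      (∀ k i, ∀ x ∈ P k, A i x ∈ P k) ∧ (∀ k l, k ≠ l → P k ⟂ P l) ∧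
      (∀ x, (∀ i, A i x = 0) → ∀ k, ∀ y ∈ P k, ⟪x, y⟫_ℝ = 0) ∧
      ∀ x ∈ W, (∀ k, ∀ y ∈ P k, ⟪x, y⟫_ℝ = 0) → ∀ i, A i x = 0 := by
  induction hn : finrank ℝ W using Nat.strong_induction_on generalizing W with
  | _ n ih =>
  by_cases hne : ∃ x ∈ W, ∃ i, A i x ≠ 0
  · obtain ⟨P₀, hP₀W, hP₀, hinv, hker⟩ :=
      exists_invariant_plane_of_commute_skew hskew hcomm hW hne
    -- Skew maps preserve the orthogonal complement of an invariant subspace, so the induction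
    -- continues there.
    have hW' : ∀ i, ∀ x ∈ W ⊓ P₀ᗮ, A i x ∈ W ⊓ P₀ᗮ := by
      rintro i x ⟨hx, hx'⟩
      refine ⟨hW i x hx, fun u hu => ?_⟩
      have h := hx' _ (hinv i u hu)
      rw [hskew] at h
      linarith
    have hlt : finrank ℝ (W ⊓ P₀ᗮ : Submodule ℝ E) < n := by
      rw [← hn]
      refine Submodule.finrank_lt_finrank_of_lt (lt_of_le_of_ne inf_le_left fun heq => ?_)
      have h1 : P₀ ≤ P₀ᗮ := hP₀W.trans (inf_eq_left.1 heq)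
      have h2 : P₀ = ⊥ := by
        rw [eq_bot_iff, ← P₀.inf_orthogonal_eq_bot]
        exact le_inf le_rfl h1
      rw [h2, finrank_bot] at hP₀
      exact absurd hP₀ (by norm_num)
    obtain ⟨s, P, hPW, hP, hPinv, hPperp, hPker, hPmax⟩ := ih _ hlt (W ⊓ P₀ᗮ) hW' rfl
    have hperp : ∀ k, P₀ ⟂ P k := fun k =>
      (Submodule.isOrtho_iff_le.2 ((hPW k).trans inf_le_right)).symm
    refine ⟨s + 1, Fin.cons P₀ P, ?_, ?_, ?_, ?_, ?_, ?_⟩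
    · exact Fin.cases hP₀W fun k => (hPW k).trans inf_le_left
    · exact Fin.cases hP₀ hP
    · exact Fin.cases hinv hPinv
    · refine Fin.cases ?_ fun k => ?_
      · refine Fin.cases (fun h => (h rfl).elim) fun l _ => hperp l
      · exact Fin.cases (fun _ => (hperp k).symm) fun l h =>
          hPperp k l fun h' => h (congrArg _ h')
    · exact fun x hx => Fin.cases (hker x hx) (hPker x hx)
    · intro x hx h
      refine hPmax x ⟨hx, fun u hu => ?_⟩ fun k => h k.succ
      rw [real_inner_comm]
      exact h 0 u hu
  · push Not at hne
    exact ⟨0, Fin.elim0, fun k => k.elim0, fun k => k.elim0, fun k => k.elim0,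
      fun k => k.elim0, fun _ _ k => k.elim0, fun x hx _ i => hne x hx i⟩

end CommutingSkew

section CommutingSkewInternal

open Module
open scoped InnerProductSpace

variable {E ι : Type*} [NormedAddCommGroup E] [InnerProductSpace ℝ E] [FiniteDimensional ℝ E]

/-- The flat part is taken to be the orthogonal complement of the sum of the planes. It is the
common kernel: the kernel is orthogonal to every plane, and the planes are exhaustive. -/
theorem exists_isInternal_invariant_planes {A : ι → E →ₗ[ℝ] E}
    (hskew : ∀ i x y, ⟪A i x, y⟫_ℝ = -⟪x, A i y⟫_ℝ)
    (hcomm : ∀ i j x, A i (A j x) = A j (A i x)) :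
    ∃ (s : ℕ) (P : Fin s → Submodule ℝ E) (U : Submodule ℝ E), (∀ k, finrank ℝ (P k) = 2) ∧
      (∀ k i, ∀ x ∈ P k, A i x ∈ P k) ∧ (∀ x, x ∈ U ↔ ∀ i, A i x = 0) ∧
      (∀ o o' : Option (Fin s), o ≠ o' → ∀ x ∈ o.elim U P, ∀ y ∈ o'.elim U P, ⟪x, y⟫_ℝ = 0) ∧
      DirectSum.IsInternal (fun o : Option (Fin s) => o.elim U P) := by
  obtain ⟨s, P, -, hP, hinv, hperp, hker, hmax⟩ :=
    exists_orthogonal_invariant_planes hskew hcomm ⊤ fun _ _ _ => Submodule.mem_top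
  have hmem : ∀ x, x ∈ (⨆ k, P k)ᗮ ↔ ∀ k, ∀ y ∈ P k, ⟪x, y⟫_ℝ = 0 := fun x => by
    rw [← Submodule.iInf_orthogonal, Submodule.mem_iInf]
    exact forall_congr' fun k => Submodule.mem_orthogonal' _ _
  have horth : ∀ o o' : Option (Fin s), o ≠ o' →
      ∀ x ∈ o.elim (⨆ k, P k)ᗮ P, ∀ y ∈ o'.elim (⨆ k, P k)ᗮ P, ⟪x, y⟫_ℝ = 0 := by
    rintro (_ | k) (_ | l) h x hx y hy
    · exact (h rfl).elim
    · exact (hmem x).1 hx l y hy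
    · rw [real_inner_comm]
      exact (hmem y).1 hy k x hx
    · exact Submodule.isOrtho_iff_inner_eq.1 (hperp k l fun h' => h (congrArg _ h')) x hx y hy
  refine ⟨s, P, (⨆ k, P k)ᗮ, hP, hinv, fun x => ⟨fun hx => ?_, fun hx => ?_⟩, horth, ?_⟩
  · exact hmax x Submodule.mem_top ((hmem x).1 hx)
  · exact (hmem x).2 (hker x hx)
  · have hfam : OrthogonalFamily ℝ (fun o : Option (Fin s) => (o.elim (⨆ k, P k)ᗮ P : Submodule ℝ E))
        fun o => (o.elim (⨆ k, P k)ᗮ P : Submodule ℝ E).subtypeₗᵢ :=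
      OrthogonalFamily.of_pairwise fun o o' h => Submodule.isOrtho_iff_inner_eq.2 (horth o o' h)
    rw [hfam.isInternal_iff, iSup_option]
    change ((⨆ k, P k)ᗮ ⊔ ⨆ k, P k)ᗮ = ⊥
    rw [sup_comm, Submodule.sup_orthogonal_of_hasOrthogonalProjection,
      Submodule.top_orthogonal_eq_bot]

end CommutingSkewInternal

/-! ### Existence of a decomposition -/

namespace CurvatureModel

open Module

variable {V : Type*} [AddCommGroup V] [Module ℝ V]

theorem curv_antisymm_right (M : CurvatureModel V) (x y z w : V) :
    M.curv x y z w = -M.curv x y w z := by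
  rw [M.curv_algebraic.pair_symm, M.curv_algebraic.antisymm, M.curv_algebraic.pair_symm]

theorem metric_left_injective (M : CurvatureModel V) {x y : V}
    (h : ∀ w, M.metric x w = M.metric y w) : x = y := by
  refine sub_eq_zero.1 (M.metric_nondegenerate.1 _ fun w => ?_)
  rw [map_sub, LinearMap.sub_apply, h, sub_self]

theorem exists_decomposition [FiniteDimensional ℝ V] (M : CurvatureModel V)
    (hM : M.IsRiemannian) (hT : M.IsSkewTsankov) :
    ∃ (s : ℕ) (D : M.Decomposition s), D.flat = M.kerCurv := by
  let core : InnerProductSpace.Core ℝ V :=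
    { inner := fun x y => M.metric x y
      conj_inner_symm := fun x y => M.metric_symm y x
      re_inner_nonneg := fun x => by
        by_cases hx : x = 0
        · simp [hx]
        · exact (hM x hx).le
      add_left := fun x y z => by simp
      smul_left := fun x y r => by simp
      definite := fun x h => by
        by_contra hx
        exact (hM x hx).ne' h }
  let _ : NormedAddCommGroup V := core.toNormedAddCommGroup
  let _ : InnerProductSpace ℝ V := InnerProductSpace.ofCore core.toCore
  obtain ⟨s, P, U, hP, hinv, hU, horth, hint⟩ :=
    exists_isInternal_invariant_planes (A := fun p : V × V => M.curvOp p.1 p.2)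
      (fun p x y => by
        change M.metric (M.curvOp p.1 p.2 x) y = -M.metric x (M.curvOp p.1 p.2 y)
        rw [M.metric_symm x, metric_curvOp, metric_curvOp, curv_antisymm_right])
      (fun p q x => LinearMap.congr_fun (hT p.1 p.2 q.1 q.2) x)
  have hmem : ∀ (o : Option (Fin s)) (z w : V), ∀ x ∈ o.elim U P, M.curvOp z w x ∈ o.elim U P := by
    rintro (_ | k) z w x hx
    · rw [(hU x).1 hx (z, w)]
      exact zero_mem U
    · exact hinv k (z, w) x hx
  -- Pair symmetry puts `x, y` into the slots of the inner product, so orthogonality and invariance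
  -- of the summands give `curv_perp`.
  have hcurv : ∀ x y z w, M.curv x y z w = M.metric (M.curvOp z w x) y := fun x y z w => by
    rw [metric_curvOp, M.curv_algebraic.pair_symm]
  have hUker : ∀ x, x ∈ U ↔ x ∈ M.kerCurv := fun x => by
    rw [hU, mem_kerCurv]
    refine ⟨fun h y z w => ?_, fun h p => M.metric_left_injective fun w => ?_⟩
    · rw [hcurv, h (z, w), map_zero, LinearMap.zero_apply]
    · rw [← hcurv, h, map_zero, LinearMap.zero_apply]
  refine ⟨s, ⟨P, U, hP, hint, horth, fun o o' h x hx y hy z w => ?_, fun x hx y _ z _ w _ => ?_⟩,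
    Submodule.ext hUker⟩
  · rw [hcurv]
    exact horth o o' h _ (hmem o z w x hx) y hy
  · exact (M.mem_kerCurv x).1 ((hUker x).1 hx) y z w

end CurvatureModel

/-! ### The Ricci operator and uniqueness of the sectional curvatures -/

namespace CurvatureModel

open Module Polynomial

variable {V : Type*} [AddCommGroup V] [Module ℝ V]

/-- Gram–Schmidt: the squared norm of `φ(e, e) f - φ(e, f) e` is `φ(e, e)` times the Gram
determinant. -/
theorem gram_pos (M : CurvatureModel V) (hM : M.IsRiemannian) {e f : V}
    (h : LinearIndependent ℝ ![e, f]) :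
    0 < M.metric e e * M.metric f f - M.metric e f ^ 2 := by
  have he : 0 < M.metric e e := hM e (h.ne_zero 0)
  have hu : M.metric e e • f - M.metric e f • e ≠ 0 := fun h0 => by
    have := (LinearIndependent.pair_iff.1 h) (-M.metric e f) (M.metric e e) (by
      rw [← h0]; module)
    exact he.ne' this.2
  have hpos := hM _ hu
  have heq : M.metric (M.metric e e • f - M.metric e f • e)
      (M.metric e e • f - M.metric e f • e)
      = M.metric e e * (M.metric e e * M.metric f f - M.metric e f ^ 2) := by
    simp only [map_sub, map_smul, LinearMap.sub_apply, LinearMap.smul_apply, smul_eq_mul,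
      M.metric_symm f e]
    ring
  rw [heq] at hpos
  exact pos_of_mul_pos_right hpos he.le

namespace Decomposition

variable {M : CurvatureModel V} {s : ℕ}

/-- The sum of the summands other than the given one. -/
noncomputable def others (D : M.Decomposition s) (o : Option (Fin s)) : Submodule ℝ V :=
  ⨆ o', ⨆ (_ : o' ≠ o), o'.elim D.flat D.plane

theorem isCompl_others (D : M.Decomposition s) (o : Option (Fin s)) :
    IsCompl (o.elim D.flat D.plane) (D.others o) := by
  refine ⟨D.isInternal.submodule_iSupIndep o, codisjoint_iff.2 ?_⟩
  rw [eq_top_iff, ← D.isInternal.submodule_iSup_eq_top]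
  refine iSup_le fun o' => ?_
  by_cases h : o' = o
  · subst h
    exact le_sup_left
  · exact le_sup_of_le_right (le_iSup₂_of_le o' h le_rfl)

theorem metric_others (D : M.Decomposition s) (o : Option (Fin s)) {x y : V}
    (hx : x ∈ D.others o) (hy : y ∈ o.elim D.flat D.plane) : M.metric x y = 0 := by
  have : D.others o ≤ LinearMap.ker (M.metric.flip y) :=
    iSup₂_le fun o' h v hv => D.metric_perp o' o h v hv y hy
  exact this hx

theorem curv_others (D : M.Decomposition s) (o : Option (Fin s)) {x y : V}
    (hx : x ∈ D.others o) (hy : y ∈ o.elim D.flat D.plane) : M.curv x y = 0 := by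
  have : D.others o ≤ LinearMap.ker (M.curv.flip y) :=
    iSup₂_le fun o' h v hv => by
      refine LinearMap.mem_ker.2 ?_
      ext z w
      exact D.curv_perp o' o h v hv y hy z w
  exact this hx

/-- The projection to a summand along the other ones. -/
noncomputable def proj (D : M.Decomposition s) (o : Option (Fin s)) : V →ₗ[ℝ] V :=
  (o.elim D.flat D.plane).projection (D.others o) (D.isCompl_others o)

theorem proj_mem (D : M.Decomposition s) (o : Option (Fin s)) (x : V) :
    D.proj o x ∈ o.elim D.flat D.plane :=
  Submodule.projection_apply_mem _ x

theorem sub_proj_mem (D : M.Decomposition s) (o : Option (Fin s)) (x : V) :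
    x - D.proj o x ∈ D.others o :=
  Submodule.sub_projection_mem _ x

theorem metric_proj (D : M.Decomposition s) (o : Option (Fin s)) (x : V) {y : V}
    (hy : y ∈ o.elim D.flat D.plane) : M.metric (D.proj o x) y = M.metric x y := by
  have := D.metric_others o (D.sub_proj_mem o x) hy
  rw [map_sub, LinearMap.sub_apply, sub_eq_zero] at this
  exact this.symm

theorem metric_proj_right (D : M.Decomposition s) (o : Option (Fin s)) {x : V} (y : V)
    (hx : x ∈ o.elim D.flat D.plane) : M.metric x (D.proj o y) = M.metric x y := by
  rw [M.metric_symm, D.metric_proj o y hx, M.metric_symm]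

theorem curv_proj_left (D : M.Decomposition s) (o : Option (Fin s)) (y : V) {x : V}
    (hx : x ∈ o.elim D.flat D.plane) (w u : V) : M.curv (D.proj o y) x w u = M.curv y x w u := by
  conv_rhs => rw [← sub_add_cancel y (D.proj o y)]
  rw [map_add, LinearMap.add_apply, D.curv_others o (D.sub_proj_mem o y) hx, zero_add]

/-- A decomposition controls `R` only when the arguments of one antisymmetric pair lie in different
summands. The Bianchi identity carries this to the last slot: its other two terms pair the foreign
component of `u` with `x` or with `y`. -/
theorem curv_proj_right (D : M.Decomposition s) (o : Option (Fin s)) {y x : V}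
    (hy : y ∈ o.elim D.flat D.plane) (hx : x ∈ o.elim D.flat D.plane) (w u : V) :
    M.curv y x w (D.proj o u) = M.curv y x w u := by
  have hR := M.curv_algebraic
  have hc := D.sub_proj_mem o u
  have h : M.curv y x w (u - D.proj o u) = 0 := by
    have hb := hR.bianchi y x w (u - D.proj o u)
    have h1 : M.curv y w (u - D.proj o u) x = 0 := by
      rw [hR.pair_symm, D.curv_others o hc hx]; rfl
    have h2 : M.curv y (u - D.proj o u) x w = 0 := by
      rw [hR.antisymm, D.curv_others o hc hy]; simp
    linarith
  rw [map_sub, sub_eq_zero] at h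
  exact h.symm

/-- For `x` and `y` in one summand, `R(y, x, w, u)` only depends on the components of `w` and `u`
in that summand. -/
theorem curv_proj (D : M.Decomposition s) (o : Option (Fin s)) (y : V) {x : V}
    (hx : x ∈ o.elim D.flat D.plane) (w u : V) :
    M.curv (D.proj o y) x (D.proj o w) (D.proj o u) = M.curv y x w u := by
  rw [D.curv_proj_right o (D.proj_mem o y) hx, curv_antisymm_right,
    D.curv_proj_right o (D.proj_mem o y) hx, ← curv_antisymm_right, D.curv_proj_left o y hx]

end Decomposition

theorem IsRiemannian.pullback {M : CurvatureModel V} (hM : M.IsRiemannian) (A : V ≃ₗ[ℝ] V) :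
    (M.pullback A).IsRiemannian :=
  fun x hx => hM (A x) (A.map_ne_zero_iff.2 hx)

variable [FiniteDimensional ℝ V]

/-- The curvature operator as a linear map in its two arguments. -/
noncomputable def curvOpHom (M : CurvatureModel V) : V →ₗ[ℝ] V →ₗ[ℝ] V →ₗ[ℝ] V :=
  LinearMap.mk₂ ℝ M.curvOp
    (fun x x' y => by simp [curvOp, LinearMap.comp_add])
    (fun c x y => by simp [curvOp, LinearMap.comp_smul])
    (fun x y y' => by simp [curvOp, LinearMap.comp_add])
    (fun c x y => by simp [curvOp, LinearMap.comp_smul])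

/-- The endomorphism `y ↦ 𝓡(y, x) w`. -/
noncomputable def jacobiHom (M : CurvatureModel V) (x w : V) : V →ₗ[ℝ] V :=
  (M.curvOpHom.flip x).flip w

theorem metric_jacobiHom (M : CurvatureModel V) (x w y u : V) :
    M.metric (M.jacobiHom x w y) u = M.curv y x w u :=
  M.metric_curvOp y x w u

/-- The Ricci tensor. -/
noncomputable def ricci (M : CurvatureModel V) : LinearMap.BilinForm ℝ V :=
  LinearMap.mk₂ ℝ (fun x w => LinearMap.trace ℝ V (M.jacobiHom x w))
    (fun x x' w => by
      rw [← map_add]; congr 1; ext y; simp [jacobiHom])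
    (fun c x w => by
      rw [← map_smul]; congr 1; ext y; simp [jacobiHom])
    (fun x w w' => by
      rw [← map_add]; congr 1; ext y; simp [jacobiHom])
    (fun c x w => by
      rw [← map_smul]; congr 1; ext y; simp [jacobiHom])

/-- The Ricci operator. -/
noncomputable def ricciOp (M : CurvatureModel V) : V →ₗ[ℝ] V :=
  ((M.metric.toDual M.metric_nondegenerate).symm : Module.Dual ℝ V →ₗ[ℝ] V) ∘ₗ M.ricci

theorem metric_ricciOp (M : CurvatureModel V) (x w : V) :
    M.metric (M.ricciOp x) w = LinearMap.trace ℝ V (M.jacobiHom x w) :=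
  LinearMap.BilinForm.apply_toDual_symm_apply (hB := M.metric_nondegenerate) _ _

namespace Decomposition

variable {M : CurvatureModel V} {s : ℕ}

/-- On each plane, the curvature tensor is the one of constant sectional curvature. -/
theorem curv_plane (D : M.Decomposition s) (hM : M.IsRiemannian) (i : Fin s) {x y z w : V}
    (hx : x ∈ D.plane i) (hy : y ∈ D.plane i) (hz : z ∈ D.plane i) (hw : w ∈ D.plane i) :
    M.curv x y z w = D.curvature i *
      (M.metric x w * M.metric y z - M.metric x z * M.metric y w) := by
  set b := finBasisOfFinrankEq ℝ (D.plane i) (D.finrank_plane i)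
  set e : V := ((b 0 : D.plane i) : V)
  set f : V := ((b 1 : D.plane i) : V)
  have hexp : ∀ v ∈ D.plane i, ∃ a c : ℝ, v = a • e + c • f := fun v hv => by
    have := b.sum_repr ⟨v, hv⟩
    rw [Fin.sum_univ_two] at this
    exact ⟨_, _, (congrArg Subtype.val this).symm⟩
  have hli : LinearIndependent ℝ ![e, f] := by
    have h := b.linearIndependent.map' (D.plane i).subtype (Submodule.ker_subtype _)
    have heq : (D.plane i).subtype ∘ b = ![e, f] := by
      ext j
      fin_cases j <;> rfl
    rwa [heq] at h
  have hg := M.gram_pos hM hli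
  have hκ : D.curvature i * (M.metric e e * M.metric f f - M.metric e f ^ 2) = M.curv e f f e :=
    div_mul_cancel₀ _ hg.ne'
  obtain ⟨x₁, x₂, rfl⟩ := hexp x hx
  obtain ⟨y₁, y₂, rfl⟩ := hexp y hy
  obtain ⟨z₁, z₂, rfl⟩ := hexp z hz
  obtain ⟨w₁, w₂, rfl⟩ := hexp w hw
  have hR := M.curv_algebraic
  have h1 : ∀ x z w, M.curv x x z w = 0 := fun x z w => by
    have := hR.antisymm x x z w
    linarith
  have h2 : ∀ x y z, M.curv x y z z = 0 := fun x y z => by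
    rw [hR.pair_symm, h1]
  have h3 : M.curv f e f e = -M.curv e f f e := by rw [hR.antisymm]
  have h5 : M.curv f e e f = M.curv e f f e := hR.pair_symm f e e f
  have h4 : M.curv e f e f = -M.curv e f f e := by rw [hR.antisymm, h5]
  simp only [map_add, map_smul, LinearMap.add_apply, LinearMap.smul_apply, smul_eq_mul,
      h1, h2, h3, h4, h5, ← hκ, M.metric_symm f e]
  ring

theorem trace_proj (D : M.Decomposition s) (o : Option (Fin s)) :
    LinearMap.trace ℝ V (D.proj o) = finrank ℝ (o.elim D.flat D.plane : Submodule ℝ V) :=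
  LinearMap.IsProj.trace ⟨D.proj_mem o, fun _ hx => Submodule.projection_apply_of_mem_left _ hx⟩

/-- With `P` the projection to the plane, `y ↦ 𝓡(y, x) w` is `κ (φ(x, w) P - φ(P w, ·) x)`. Its
trace is `κ (2 φ(x, w) - φ(x, w))`, since `P` has rank two. -/
theorem ricciOp_plane (D : M.Decomposition s) (hM : M.IsRiemannian) (i : Fin s) {x : V}
    (hx : x ∈ D.plane i) : M.ricciOp x = D.curvature i • x := by
  refine M.metric_left_injective fun w => ?_
  rw [metric_ricciOp]
  have hj : M.jacobiHom x w = D.curvature i •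
      (M.metric x w • D.proj (some i) - (M.metric (D.proj (some i) w)).smulRight x) := by
    refine LinearMap.ext fun y => M.metric_left_injective fun u => ?_
    rw [metric_jacobiHom, ← D.curv_proj (some i) y hx w u, D.curv_plane hM i (D.proj_mem (some i) y) hx
      (D.proj_mem (some i) w) (D.proj_mem (some i) u), D.metric_proj_right (some i) u (D.proj_mem _ _),
      D.metric_proj_right (some i) w hx, D.metric_proj_right (some i) u hx,
      D.metric_proj (some i) y (D.proj_mem _ _), M.metric_symm y]
    simp only [LinearMap.smul_apply, LinearMap.sub_apply, LinearMap.smulRight_apply, map_smul,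
      map_sub, smul_eq_mul]
    ring
  rw [hj, map_smul, map_sub, map_smul, D.trace_proj, LinearMap.trace_smulRight,
    D.metric_proj (some i) w hx, M.metric_symm w x]
  change D.curvature i • (M.metric x w • (finrank ℝ (D.plane i) : ℝ) - M.metric x w) = _
  rw [D.finrank_plane, map_smul, LinearMap.smul_apply, smul_eq_mul, smul_eq_mul, smul_eq_mul]
  push_cast
  ring

theorem ricciOp_flat (D : M.Decomposition s) {x : V} (hx : x ∈ D.flat) : M.ricciOp x = 0 := by
  refine M.metric_left_injective fun w => ?_
  have hj : M.jacobiHom x w = 0 := by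
    refine LinearMap.ext fun y => M.metric_left_injective fun u => ?_
    rw [metric_jacobiHom, ← D.curv_proj none y hx w u, D.curv_flat _ (D.proj_mem none y) x hx _
      (D.proj_mem none w) _ (D.proj_mem none u)]
    simp
  rw [metric_ricciOp, hj]
  simp

/-- Bases of the summands of a decomposition, joined to a basis of the whole space. -/
noncomputable def basis (D : M.Decomposition s) :
    Basis (Σ o : Option (Fin s), Fin (finrank ℝ (o.elim D.flat D.plane : Submodule ℝ V))) ℝ V :=
  D.isInternal.collectedBasis fun o => finBasis ℝ (o.elim D.flat D.plane : Submodule ℝ V)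

theorem basis_mem (D : M.Decomposition s) (p) : D.basis p ∈ p.1.elim D.flat D.plane :=
  D.isInternal.collectedBasis_mem _ p

/-- Used in both directions: the flat dimension determines the length, and the length determines the
flat dimension. -/
theorem finrank_eq (D : M.Decomposition s) : finrank ℝ V = finrank ℝ D.flat + 2 * s := by
  rw [finrank_eq_card_basis D.basis, Fintype.card_sigma, Fintype.sum_option]
  simp only [Fintype.card_fin]
  change finrank ℝ D.flat + ∑ i, finrank ℝ (D.plane i) = _
  simp [D.finrank_plane, mul_comm]

/-- The Ricci operator is diagonal in a basis adapted to the summands. Planes with `κ i = 0` also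
contribute factors `X`, so the curvatures can be compared only for equal lengths. -/
theorem charpoly_ricciOp (D : M.Decomposition s) (hM : M.IsRiemannian) :
    M.ricciOp.charpoly = X ^ finrank ℝ D.flat * (∏ i, (X - C (D.curvature i))) ^ 2 := by
  have hmat : LinearMap.toMatrix D.basis D.basis M.ricciOp =
      Matrix.diagonal fun p => p.1.elim 0 D.curvature := by
    have happ : ∀ p, M.ricciOp (D.basis p) = p.1.elim 0 D.curvature • D.basis p := by
      rintro ⟨_ | i, k⟩
      · rw [D.ricciOp_flat (D.basis_mem ⟨none, k⟩)]
        simp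
      · exact D.ricciOp_plane hM i (D.basis_mem ⟨some i, k⟩)
    ext p q
    rw [LinearMap.toMatrix_apply, happ, map_smul, Basis.repr_self, Finsupp.smul_apply,
      Matrix.diagonal_apply, Finsupp.single_apply]
    rcases eq_or_ne p q with rfl | h
    · simp
    · simp [h, h.symm]
  have hprod : ∀ o : Option (Fin s),
      ∏ _k : Fin (finrank ℝ (o.elim D.flat D.plane : Submodule ℝ V)),
        (X - C (o.elim 0 D.curvature) : ℝ[X]) =
      (X - C (o.elim 0 D.curvature)) ^ finrank ℝ (o.elim D.flat D.plane : Submodule ℝ V) :=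
    fun o => by rw [Finset.prod_const, Finset.card_univ, Fintype.card_fin]
  rw [← LinearMap.charpoly_toMatrix _ D.basis, hmat, Matrix.charpoly_diagonal,
    Fintype.prod_sigma, Finset.prod_congr rfl fun o _ => hprod o, Fintype.prod_option,
    ← Finset.prod_pow]
  refine congrArg₂ _ ?_ (Finset.prod_congr rfl fun i _ => ?_)
  · rw [Option.elim_none, C_0, sub_zero]
    rfl
  · exact congrArg _ (D.finrank_plane i)

/-- The sectional curvatures of the planes of two decompositions of the same length agree up to
a permutation. -/
theorem exists_perm_curvature (D : M.Decomposition s) (hM : M.IsRiemannian)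
    (E : M.Decomposition s) :
    ∃ σ : Equiv.Perm (Fin s), E.curvature = D.curvature ∘ σ := by
  have hflat : finrank ℝ D.flat = finrank ℝ E.flat := by
    have := D.finrank_eq.symm.trans E.finrank_eq
    omega
  have h := (D.charpoly_ricciOp hM).symm.trans (E.charpoly_ricciOp hM)
  rw [hflat] at h
  have h2 := mul_left_cancel₀ (pow_ne_zero _ X_ne_zero) h
  have hroots : ∀ k : Fin s → ℝ, ((∏ i, (X - C (k i))) ^ 2).roots =
      2 • Finset.univ.val.map k := fun k => by
    rw [roots_pow, roots_prod _ _ (Finset.prod_ne_zero_iff.2 fun i _ => X_sub_C_ne_zero _)]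
    simp
  have h3 := congrArg Polynomial.roots h2
  rw [hroots, hroots] at h3
  -- Each value is taken equally often by both families; bijections between the fibres assemble to a
  -- permutation.
  have hcard : ∀ c, Fintype.card {i // E.curvature i = c} = Fintype.card {i // D.curvature i = c} := by
    intro c
    have h4 := congrArg (Multiset.count c) h3
    rw [Multiset.count_nsmul, Multiset.count_nsmul] at h4
    have h5 := mul_left_cancel₀ two_ne_zero h4
    simp only [Multiset.count_map] at h5
    rw [Fintype.card_subtype, Fintype.card_subtype]
    simpa [Finset.card_def, eq_comm] using h5.symm
  exact ⟨Equiv.ofFiberEquiv fun c => Fintype.equivOfCardEq (hcard c),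
    funext fun i => (Equiv.ofFiberEquiv_map _ i).symm⟩

/-! ### Pullback and invariance -/

/-- The pullback of a decomposition. -/
def pullback (D : M.Decomposition s) (A : V ≃ₗ[ℝ] V) : (M.pullback A).Decomposition s where
  plane i := (D.plane i).comap (A : V →ₗ[ℝ] V)
  flat := D.flat.comap (A : V →ₗ[ℝ] V)
  finrank_plane i := by
    rw [← D.finrank_plane i]
    rw [Submodule.comap_equiv_eq_map_symm]
    exact LinearEquiv.finrank_map_eq A.symm (D.plane i)
  isInternal := by
    have h := D.isInternal
    rw [DirectSum.isInternal_submodule_iff_iSupIndep_and_iSup_eq_top] at h ⊢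
    have heq : (fun o : Option (Fin s) => o.elim (D.flat.comap (A : V →ₗ[ℝ] V))
        fun i => (D.plane i).comap (A : V →ₗ[ℝ] V)) =
        (Submodule.orderIsoMapComap A).symm ∘ fun o => o.elim D.flat D.plane := by
      funext o
      cases o <;> rfl
    rw [heq, iSupIndep_map_orderIso_iff]
    refine ⟨h.1, ?_⟩
    rw [← (Submodule.orderIsoMapComap A).symm.map_top, ← h.2, OrderIso.map_iSup]
    rfl
  metric_perp := by
    rintro (_ | i) (_ | j) h x hx y hy <;> exact D.metric_perp _ _ h (A x) hx (A y) hy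
  curv_perp := by
    rintro (_ | i) (_ | j) h x hx y hy z w <;>
      exact D.curv_perp _ _ h (A x) hx (A y) hy (A z) (A w)
  curv_flat x hx y hy z hz w hw := D.curv_flat (A x) hx (A y) hy (A z) hz (A w) hw

/-- `A` carries a basis of the pulled-back plane to a basis of the original one, with the same
values of both tensors by definition; independence of the basis does the rest. -/
theorem curvature_pullback (D : M.Decomposition s) (A : V ≃ₗ[ℝ] V) :
    (D.pullback A).curvature = D.curvature := by
  funext i
  let e : (D.pullback A).plane i ≃ₗ[ℝ] D.plane i :=
    A.ofSubmodules _ _ (Submodule.map_comap_eq_of_surjective A.surjective (D.plane i))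
  let b := finBasisOfFinrankEq ℝ _ ((D.pullback A).finrank_plane i)
  rw [D.curvature_eq i (b.map e)]
  rfl

end Decomposition

theorem curvOp_pullback (M : CurvatureModel V) (A : V ≃ₗ[ℝ] V) (x y z : V) :
    A ((M.pullback A).curvOp x y z) = M.curvOp (A x) (A y) (A z) := by
  refine M.metric_left_injective fun w => ?_
  have h := (M.pullback A).metric_curvOp x y z (A.symm w)
  change M.metric (A _) (A (A.symm w)) = M.curv (A x) (A y) (A z) (A (A.symm w)) at h
  rw [A.apply_symm_apply] at h
  rw [h, metric_curvOp]

theorem IsSkewTsankov.pullback {M : CurvatureModel V} (hM : M.IsSkewTsankov) (A : V ≃ₗ[ℝ] V) :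
    (M.pullback A).IsSkewTsankov := fun x y z w => by
  refine LinearMap.ext fun v => A.injective ?_
  simp only [LinearMap.comp_apply, curvOp_pullback]
  exact LinearMap.congr_fun (hM (A x) (A y) (A z) (A w)) (A v)

theorem exists_isCurvatureFunction {K : Type*} {s : ℕ} {F : (Fin s → ℝ) → K}
    (hF : IsSymmetricFunction F) : ∃ α : CurvatureModel V → K, IsCurvatureFunction F α := by
  classical
  -- The value `0` serves only models without a decomposition of length `s`, on which nothing is
  -- required.
  refine ⟨fun N => F (if h : Nonempty (N.Decomposition s) then h.some.curvature else 0),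
    fun N hN _ E => ?_⟩
  have h : Nonempty (N.Decomposition s) := ⟨E⟩
  obtain ⟨σ, hσ⟩ := E.exists_perm_curvature hN h.some
  simp only [h, dite_true]
  rw [hσ, hF]

theorem IsCurvatureFunction.isInvariant {K : Type*} {s : ℕ} {F : (Fin s → ℝ) → K}
    {α : CurvatureModel V → K} (hα : IsCurvatureFunction F α) {M : CurvatureModel V}
    (hM : M.IsRiemannian) (hT : M.IsSkewTsankov) (D : M.Decomposition s) (T : Set TensorLabel) :
    M.IsInvariant T α := fun A _ => by
  rw [hα M hM hT D, hα _ (hM.pullback A) (hT.pullback A) (D.pullback A), D.curvature_pullback]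

end CurvatureModel

theorem theorem5p3 {V : Type*} [AddCommGroup V] [Module ℝ V] [FiniteDimensional ℝ V] (K : Type*)
    (M : CurvatureModel V) (hM : M.IsRiemannian) (hT : M.IsSkewTsankov) :
    (∃ (s : ℕ) (D : M.Decomposition s), D.flat = M.kerCurv) ∧
    (∀ (s t : ℕ) (D : M.Decomposition s) (E : M.Decomposition t),
      D.flat = M.kerCurv → E.flat = M.kerCurv → s = t) ∧
    (∀ (s : ℕ) (_ : M.Decomposition s) (F : (Fin s → ℝ) → K), IsSymmetricFunction F →
      (∃ α : CurvatureModel V → K, CurvatureModel.IsCurvatureFunction F α) ∧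
      ∀ α : CurvatureModel V → K, CurvatureModel.IsCurvatureFunction F α →
        ∀ T : Set TensorLabel, M.IsInvariant T α) := by
  refine ⟨M.exists_decomposition hM hT, fun s t D E hD hE => ?_, fun s D F hF =>
    ⟨CurvatureModel.exists_isCurvatureFunction hF, fun α hα T => hα.isInvariant hM hT D T⟩⟩
  have h := D.finrank_eq.symm.trans E.finrank_eq
  rw [hD, hE] at h
  omega
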